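/- Let $r,n\ge 0$ and let $A=(a_{j,i})$ be an $r\times n$ integer matrix such that $A\alpha=\mathbf 0$ has a solution $\alpha$ with all entries positive integers. Let $\Lambda=(\lambda_1,\dots,\lambda_r)$ and $\mathbf x=(x_1,\dots,x_n)$ be variables, and let $$\mathcal E(\Lambda,\mathbf x)=\prod_{i=1}^n\frac{1}{1-\lambda_1^{a_{1,i}}\cdots\lambda_r^{a_{r,i}}\,x_i}\in\mathbb C(\Lambda,\mathbf x).$$ For an injective endomorphism $\rho$ of the group $\mathbb Z^{r+n}$ of monomials in $\lambda_1,\dots,\lambda_r,x_1,\dots,x_n$ (in this order), let $a\le^\rho b$ if and only if $\rho(a)\le\rho(b)$ in the reverse lexicographical order (compare the last entries that differ), let $\mathbb C^\rho\langle\langle\Lambda,\mathbf x\rangle\rangle$ be the field of Malcev-Neumann series for $\le^\rho$ (formal sums of monomials with complex coefficients and with well-ordered support), in which every rational function has a unique expansion, and let $\mathrm{CT}^\rho_\Lambda F$ be the sum of those terms of the expansion of $F$ that do not involve any $\lambda_j$. Write $\mathrm{CT}_\Lambda$ for $\rho=\mathrm{id}$. Let $\rho$ be the endomorphism defined by $\rho(x_i)=x_i^{-1}$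 and $\rho(\lambda_j)=\lambda_j$. Then $\mathrm{CT}_\Lambda\,\mathcal E$ and $\mathrm{CT}^\rho_\Lambda\,\mathcal E$ are expansions (in the respective fields) of rational functions in $\mathbb C(\mathbf x)$, and as rational functions $$\mathrm{CT}_\Lambda\,\mathcal E=(-1)^{\operatorname{rank}A}\,\mathrm{CT}^\rho_\Lambda\,\mathcal E .$$ Moreover, the generating functions $E(\mathbf x)=\sum \mathbf x^\alpha$ over all $\alpha\in\mathbb Z_{\ge0}^n$ with $A\alpha=\mathbf 0$, and $\bar E(\mathbf x)=\sum\mathbf x^\alpha$ over all $\alpha\in\mathbb Z_{>0}^n$ with $A\alpha=\mathbf 0$, are rational functions, $E(\mathbf x)=\mathrm{CT}_\Lambda\,\mathcal E$, and $$E(\mathbf x)=(-1)^{\,n-\operatorname{rank}A}\,\bar E(x_1^{-1},\dots,x_n^{-1})$$ as rational functions. -/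

import Mathlib

open scoped Matrix

noncomputable section

namespace MNRecip

/-- The field of rational functions over the complex numbers in the variables indexed by `σ`. -/
abbrev RatFun (σ : Type) : Type := FractionRing (MvPolynomial σ ℂ)

/-- The rational function given by the variable with index `i`. -/
def RatFun.var {σ : Type} (i : σ) : RatFun σ := algebraMap (MvPolynomial σ ℂ) _ (MvPolynomial.X i)

/-- Injective endomorphisms of the additive group `ℤ^N`. -/
abbrev Endo (N : ℕ) : Type := {ρ : (Fin N → ℤ) →+ (Fin N → ℤ) // Function.Injective ρ}

/-- The group `ℤ^N` of exponent vectors of Laurent monomials in `N` variables, to be ordered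
through the endomorphism `ρ`. -/
def Expo {N : ℕ} (_ρ : Endo N) : Type := Fin N → ℤ

namespace Expo

variable {N : ℕ} {ρ : Endo N}

instance : AddCommGroup (Expo ρ) := inferInstanceAs (AddCommGroup (Fin N → ℤ))

/-- The vector of exponents. -/
def toVec (ρ : Endo N) : Expo ρ ≃+ (Fin N → ℤ) := AddEquiv.refl (Fin N → ℤ)

/-- The total order `a ≤^ρ b` if and only if `ρ a ≤ ρ b` in the reverse lexicographical order
(the entries of two vectors are compared at the last position where they differ). -/
instance : LinearOrder (Expo ρ) :=
  LinearOrder.lift' (fun a : Expo ρ => toColex (ρ.1 (toVec ρ a)))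
    (fun _ _ h => (toVec ρ).injective (ρ.2 (toColex.injective h)))

theorem lt_iff (a b : Expo ρ) :
    a < b ↔ ∃ i, (∀ j, i < j → ρ.1 (toVec ρ a) j = ρ.1 (toVec ρ b) j) ∧
      ρ.1 (toVec ρ a) i < ρ.1 (toVec ρ b) i :=
  Iff.rfl

instance : IsOrderedAddMonoid (Expo ρ) where
  add_le_add_left a b hab c := by
    rcases hab.eq_or_lt with rfl | h
    · exact le_rfl
    · obtain ⟨i, h1, h2⟩ := (lt_iff a b).1 h
      refine le_of_lt ((lt_iff _ _).2 ⟨i, fun j hj => ?_, ?_⟩)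
      · simp only [map_add, Pi.add_apply, h1 j hj]
      · simpa only [map_add, Pi.add_apply, add_lt_add_iff_right] using h2

/-- The exponent vector of the variable with index `i`. -/
def unit (ρ : Endo N) (i : Fin N) : Expo ρ := (toVec ρ).symm (Pi.single i 1)

end Expo

/-- The field of Malcev-Neumann series with complex coefficients with respect to the order `≤^ρ`:
formal series in Laurent monomials whose support is well-ordered. -/
abbrev MNSeries {N : ℕ} (ρ : Endo N) : Type := HahnSeries (Expo ρ) ℂ

section Injectivity

variable {τ Γ : Type} [AddCommGroup Γ] [LinearOrder Γ] [IsOrderedAddMonoid Γ]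

theorem eval_single_apply (φ : (τ →₀ ℕ) →+ Γ) (p : MvPolynomial τ ℂ) :
    MvPolynomial.eval₂Hom (HahnSeries.C : ℂ →+* HahnSeries Γ ℂ)
      (fun i => HahnSeries.single (φ (Finsupp.single i 1)) 1) p =
      ∑ d ∈ p.support, HahnSeries.single (φ d) (p.coeff d) := by
  rw [MvPolynomial.coe_eval₂Hom, MvPolynomial.eval₂_eq]
  refine Finset.sum_congr rfl fun d _ => ?_
  have key : ∀ s : Finset τ,
      ∏ i ∈ s, (HahnSeries.single (φ (Finsupp.single i 1)) (1 : ℂ)) ^ d i =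
        HahnSeries.single (φ (∑ i ∈ s, Finsupp.single i (d i))) 1 := by
    classical
    intro s
    induction s using Finset.induction_on with
    | empty => simp
    | insert a s ha ih =>
      rw [Finset.prod_insert ha, ih, Finset.sum_insert ha, HahnSeries.single_pow,
        HahnSeries.single_mul_single, map_add, ← map_nsmul]
      simp
  rw [key, HahnSeries.C_apply, HahnSeries.single_mul_single, zero_add, mul_one]
  congr 2
  exact congrArg φ d.sum_single

theorem eval_single_injective (φ : (τ →₀ ℕ) →+ Γ) (hφ : Function.Injective φ) :
    Function.Injective (MvPolynomial.eval₂Hom (HahnSeries.C : ℂ →+* HahnSeries Γ ℂ)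
      (fun i => HahnSeries.single (φ (Finsupp.single i 1)) 1)) := by
  classical
  rw [injective_iff_map_eq_zero]
  intro p hp
  rw [eval_single_apply] at hp
  ext d
  have h := congrArg (fun f : HahnSeries Γ ℂ => f.coeff (φ d)) hp
  simp only [HahnSeries.coeff_sum, HahnSeries.coeff_single, hφ.eq_iff] at h
  simpa using h

end Injectivity

/-- The endomorphism which fixes every variable. -/
def idEndo (N : ℕ) : Endo N := ⟨AddMonoidHom.id _, Function.injective_id⟩

section Expansion

variable {N : ℕ}

/-- The embedding of exponent vectors of polynomials into `ℤ^N`. -/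
def natExpo (ρ : Endo N) : (Fin N →₀ ℕ) →+ Expo ρ where
  toFun d := (Expo.toVec ρ).symm (fun i => (d i : ℤ))
  map_zero' := by
    rw [AddEquiv.symm_apply_eq]; funext i; simp
  map_add' d e := by
    rw [← map_add]; congr 1

theorem natExpo_injective (ρ : Endo N) : Function.Injective (natExpo ρ) := by
  intro d e h
  ext i
  exact Nat.cast_injective (R := ℤ) (congrFun ((Expo.toVec ρ).symm.injective h) i)

theorem natExpo_single (ρ : Endo N) (i : Fin N) :
    natExpo ρ (Finsupp.single i 1) = Expo.unit ρ i := by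
  change (Expo.toVec ρ).symm _ = (Expo.toVec ρ).symm _
  congr 1
  funext j
  by_cases h : i = j
  · subst h; simp
  · simp [Ne.symm h]

/-- A polynomial, seen as a Malcev-Neumann series (with finite support). -/
def polyToMN (ρ : Endo N) : MvPolynomial (Fin N) ℂ →+* MNSeries ρ :=
  MvPolynomial.eval₂Hom HahnSeries.C (fun i => HahnSeries.single (Expo.unit ρ i) 1)

theorem polyToMN_injective (ρ : Endo N) : Function.Injective (polyToMN ρ) := by
  have h := eval_single_injective (natExpo ρ) (natExpo_injective ρ)
  simp only [natExpo_single] at h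
  exact h

/-- The expansion of a rational function in the field of Malcev-Neumann series for `ρ`: the unique
field embedding which extends the one of polynomials. -/
def expand (ρ : Endo N) : RatFun (Fin N) →+* MNSeries ρ :=
  IsFractionRing.lift (polyToMN_injective ρ)

/-- The constant term in the variables with index in `S`: the sum of those terms in which no
variable with index in `S` occurs. -/
def CT {ρ : Endo N} (S : Set (Fin N)) (f : MNSeries ρ) : MNSeries ρ where
  coeff a := open Classical in if ∀ i ∈ S, Expo.toVec ρ a i = 0 then f.coeff a else 0
  isPWO_support' := f.isPWO_support.mono fun a ha => by
    classical
    rw [Function.mem_support] at ha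
    rw [HahnSeries.mem_support]
    intro h0
    exact ha (by simp [h0])

end Expansion

section Rational

variable {n : ℕ}

theorem eval_inv_injective : Function.Injective
    (MvPolynomial.eval₂Hom (algebraMap ℂ (RatFun (Fin n))) (fun i => (RatFun.var i)⁻¹)) := by
  have h := eval_single_injective (-natExpo (idEndo n))
    (fun _ _ h => natExpo_injective _ (neg_injective h))
  have hcomp : (expand (idEndo n)).comp (MvPolynomial.eval₂Hom (algebraMap ℂ (RatFun (Fin n)))
      (fun i => (RatFun.var i)⁻¹)) =
      MvPolynomial.eval₂Hom (HahnSeries.C : ℂ →+* MNSeries (idEndo n))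
        (fun i => HahnSeries.single ((-natExpo (idEndo n)) (Finsupp.single i 1)) 1) := by
    apply MvPolynomial.ringHom_ext
    · intro c
      simp only [RingHom.comp_apply, MvPolynomial.coe_eval₂Hom, MvPolynomial.eval₂_C]
      rw [IsScalarTower.algebraMap_apply ℂ (MvPolynomial (Fin n) ℂ), expand,
        IsFractionRing.lift_algebraMap, MvPolynomial.algebraMap_eq, polyToMN,
        MvPolynomial.coe_eval₂Hom, MvPolynomial.eval₂_C]
    · intro i
      simp only [RingHom.comp_apply, MvPolynomial.coe_eval₂Hom, MvPolynomial.eval₂_X]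
      rw [map_inv₀, RatFun.var, expand, IsFractionRing.lift_algebraMap, polyToMN,
        MvPolynomial.coe_eval₂Hom, MvPolynomial.eval₂_X]
      apply inv_eq_of_mul_eq_one_right
      rw [HahnSeries.single_mul_single, AddMonoidHom.neg_apply, natExpo_single]
      simp
  rw [← hcomp, RingHom.coe_comp] at h
  exact Function.Injective.of_comp h

/-- The substitution `F(x) ↦ F(x⁻¹)` on rational functions. -/
def invVars : RatFun (Fin n) →+* RatFun (Fin n) := IsFractionRing.lift eval_inv_injective

instance : IsDomain (MvPowerSeries (Fin n) ℂ) := NoZeroDivisors.to_isDomain _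

/-- A rational function, seen as a quotient of two formal power series. -/
def toSeriesQuot : RatFun (Fin n) →+* FractionRing (MvPowerSeries (Fin n) ℂ) :=
  IsFractionRing.map (j := (MvPolynomial.coeToMvPowerSeries.ringHom :
    MvPolynomial (Fin n) ℂ →+* MvPowerSeries (Fin n) ℂ)) (MvPolynomial.coe_injective _ _)

/-- The formal power series `f` is the rational function `F`. -/
def IsRatFun (f : MvPowerSeries (Fin n) ℂ) (F : RatFun (Fin n)) : Prop :=
  algebraMap _ (FractionRing (MvPowerSeries (Fin n) ℂ)) f = toSeriesQuot F

end Rational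

section System

variable {r n : ℕ}

/-- The variables are ordered as `λ_1, …, λ_r, x_1, …, x_n`; these are the indices of the `λ_j`. -/
def lamVars (r n : ℕ) : Set (Fin (r + n)) := Set.range (Fin.castAdd n)

/-- The variable `λ_j`, as a rational function of all variables. -/
def lam (j : Fin r) : RatFun (Fin (r + n)) := RatFun.var (Fin.castAdd n j)

/-- The inclusion of the rational functions in `x_1, …, x_n` into those in all variables. -/
def inclX (r n : ℕ) : RatFun (Fin n) →+* RatFun (Fin (r + n)) :=
  IsFractionRing.map (j := (MvPolynomial.rename (R := ℂ) (Fin.natAdd r : Fin n → _)).toRingHom)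
    (MvPolynomial.rename_injective _ (Fin.natAdd_injective n r))

/-- The crude generating function `∏ i, 1 / (1 - λ_1^{a_{1,i}} ⋯ λ_r^{a_{r,i}} x_i)`. -/
def crude (A : Matrix (Fin r) (Fin n) ℤ) : RatFun (Fin (r + n)) :=
  ∏ i : Fin n, (1 - (∏ j : Fin r, lam j ^ A j i) * RatFun.var (Fin.natAdd r i))⁻¹

/-- The endomorphism with `λ_j ↦ λ_j` and `x_i ↦ x_i⁻¹`. -/
def rhoInv (r n : ℕ) : Endo (r + n) where
  val :=
    { toFun := fun a k => if (k : ℕ) < r then a k else -a k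
      map_zero' := by funext k; simp
      map_add' := fun a b => by
        funext k
        by_cases h : (k : ℕ) < r
        · simp [h]
        · simp [h, add_comm] }
  property a b h := by
    funext k
    have hk := congrFun h k
    by_cases h' : (k : ℕ) < r <;> simpa [h'] using hk

/-- `E(x)`, the generating function of the nonnegative integral solutions of `A α = 0`. -/
def genE (A : Matrix (Fin r) (Fin n) ℤ) : MvPowerSeries (Fin n) ℂ :=
  fun α => if A *ᵥ (fun i => (α i : ℤ)) = 0 then 1 else 0

/-- `Ē(x)`, the generating function of the positive integral solutions of `A α = 0`. -/
def genEbar (A : Matrix (Fin r) (Fin n) ℤ) : MvPowerSeries (Fin n) ℂ :=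
  fun α => if (∀ i, 0 < α i) ∧ A *ᵥ (fun i => (α i : ℤ)) = 0 then 1 else 0

/-- The rank of an integer matrix. -/
def rk (A : Matrix (Fin r) (Fin n) ℤ) : ℕ := (A.map (Int.cast : ℤ → ℚ)).rank

end System

end MNRecip

end

/-! Both constant terms come from geometric series. For the identity order every factor of the
product expands in nonnegative powers of its monomial `m`, so the constant term is the sum of `x^α`
over solutions with all `α i ≥ 0`. For `ρ` each factor expands as `-m⁻¹ / (1 - m⁻¹)`, which gives
`(-1)^n` times the sum over solutions with all `α i < 0`. Since `x ↦ x⁻¹` carries negative solutions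
to positive ones, everything reduces to one claim: the nonnegative and the negative solutions have
the same rational sum up to the sign `(-1)^(n - rank A)`.

This is proved in the module of two-sided formal Laurent series over the polynomial ring. A series
that some nonzero polynomial multiplies into the polynomials has a unique rational sum, and torsion
series do not affect it. For a set `M` of coordinates and a sign pattern on `M`, consider the
solutions with these signs (`cell`). Adding the two cells that differ only in the sign at `i`
removes the condition at `i`, so by induction on `M` a sign flip acts as multiplication by `-1`,
modulo smaller sets.

By `solution_space_trichotomy` there are three cases. If a nonzero solution `u` vanishes on `M`, the
cells are `u`-periodic, hence torsion. If the coordinates in `M` satisfy a linear relation, the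
positive solution forces coefficients of both signs, and some pattern has both its cell and the
opposite cell empty. Otherwise `M` is a coordinate system of size `n - rank A`, and flipping all
signs produces exactly the required sign. The same induction (`cellDiff_mem_sat`) proves summability
(`cell_mem_sat`) and reciprocity (`cellDiff_mem_torsion`). -/

noncomputable section

namespace MNRecip

/-! ### Formal Laurent series as a module over polynomials, and saturation -/

/-- Arbitrary (two-sided infinite) formal Laurent series, as functions on the lattice `ℤ^n`. -/
abbrev LatFun (n : ℕ) : Type := (Fin n → ℤ) → ℂ

namespace LatFun

variable {n : ℕ}

@[simp] theorem add_apply (f g : LatFun n) (a : Fin n → ℤ) : (f + g) a = f a + g a := rfl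

@[simp] theorem sub_apply (f g : LatFun n) (a : Fin n → ℤ) : (f - g) a = f a - g a := rfl

@[simp] theorem zero_apply (a : Fin n → ℤ) : (0 : LatFun n) a = 0 := rfl

@[simp] theorem smul_apply (c : ℂ) (f : LatFun n) (a : Fin n → ℤ) : (c • f) a = c * f a := rfl

theorem sum_apply {ι : Type*} (s : Finset ι) (f : ι → LatFun n) (a : Fin n → ℤ) :
    (∑ i ∈ s, f i) a = ∑ i ∈ s, f i a :=
  Finset.sum_apply (M := fun _ : Fin n → ℤ => ℂ) a s f

@[ext] theorem ext {f g : LatFun n} (h : ∀ a, f a = g a) : f = g := funext h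

/-- Multiplication by the Laurent monomial with exponent vector `d`. -/
def shift (d : Fin n → ℤ) : Module.End ℂ (LatFun n) where
  toFun f a := f (a - d)
  map_add' _ _ := rfl
  map_smul' _ _ := rfl

@[simp] theorem shift_apply (d : Fin n → ℤ) (f : LatFun n) (a : Fin n → ℤ) :
    shift d f a = f (a - d) := rfl

/-- The exponent vector of a monomial, as an integer vector. -/
def vec (d : Fin n →₀ ℕ) : Fin n → ℤ := fun i => d i

@[simp] theorem vec_apply (d : Fin n →₀ ℕ) (i : Fin n) : vec d i = d i := rfl

theorem vec_injective : Function.Injective (vec (n := n)) := fun d e h => by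
  ext i
  exact Nat.cast_injective (R := ℤ) (congrFun h i)

theorem vec_add (d e : Fin n →₀ ℕ) : vec (d + e) = vec d + vec e := by
  funext i; simp

/-- The action of polynomials on formal Laurent series by multiplication. -/
def act : MvPolynomial (Fin n) ℂ →ₐ[ℂ] Module.End ℂ (LatFun n) :=
  AddMonoidAlgebra.lift ℂ _ _
    { toFun := fun d => shift (vec d.toAdd)
      map_one' := by
        ext f a
        simp only [shift_apply, Module.End.one_apply]
        congr 1; funext i; simp
      map_mul' := fun d e => by
        ext f a
        simp only [toAdd_mul, vec_add, shift_apply, Module.End.mul_apply]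
        congr 1; abel }

instance : Module (MvPolynomial (Fin n) ℂ) (LatFun n) := Module.compHom _ (act (n := n)).toRingHom

theorem poly_smul_def (p : MvPolynomial (Fin n) ℂ) (f : LatFun n) : p • f = act p f := rfl

theorem monomial_smul (d : Fin n →₀ ℕ) (c : ℂ) (f : LatFun n) :
    MvPolynomial.monomial d c • f = c • shift (vec d) f := by
  rw [poly_smul_def, act]
  erw [AddMonoidAlgebra.lift_single]
  rfl

theorem monomial_smul_apply (d : Fin n →₀ ℕ) (c : ℂ) (f : LatFun n) (a : Fin n → ℤ) :
    (MvPolynomial.monomial d c • f) a = c * f (a - vec d) := by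
  rw [monomial_smul, smul_apply, shift_apply]

theorem poly_smul_apply (p : MvPolynomial (Fin n) ℂ) (f : LatFun n) (a : Fin n → ℤ) :
    (p • f) a = ∑ d ∈ p.support, p.coeff d * f (a - vec d) := by
  conv_lhs => rw [p.as_sum, Finset.sum_smul, sum_apply]
  simp only [monomial_smul_apply]

theorem C_smul (c : ℂ) (f : LatFun n) : (MvPolynomial.C c : MvPolynomial (Fin n) ℂ) • f = c • f := by
  ext a
  rw [← MvPolynomial.monomial_zero', monomial_smul_apply]
  simp only [smul_apply]
  congr 2
  funext i; simp

theorem mem_of_mem_smul (W : Submodule (MvPolynomial (Fin n) ℂ) (LatFun n)) {f : LatFun n}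
    (hf : f ∈ W) (c : ℂ) : c • f ∈ W := by
  rw [← C_smul]; exact W.smul_mem _ hf

/-- The constant series `1`. -/
def one : LatFun n := fun a => if a = 0 then 1 else 0

theorem poly_smul_one_vec (p : MvPolynomial (Fin n) ℂ) (d : Fin n →₀ ℕ) :
    (p • (one : LatFun n)) (vec d) = p.coeff d := by
  rw [poly_smul_apply]
  simp only [one, sub_eq_zero, vec_injective.eq_iff, mul_ite, mul_one, mul_zero, Finset.sum_ite_eq,
    MvPolynomial.mem_support_iff, ite_not]
  split_ifs with h
  · exact h.symm
  · rfl

/-- Torsion-freeness of the series `1`; this is what makes the rational sum of a series unique. -/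
theorem eq_zero_of_poly_smul_one {p : MvPolynomial (Fin n) ℂ} (h : p • (one : LatFun n) = 0) :
    p = 0 := by
  ext d
  rw [← poly_smul_one_vec, h]
  simp

/-- The series which are torsion modulo a given submodule. -/
def sat (W : Submodule (MvPolynomial (Fin n) ℂ) (LatFun n)) :
    Submodule (MvPolynomial (Fin n) ℂ) (LatFun n) where
  carrier := {f | ∃ q : MvPolynomial (Fin n) ℂ, q ≠ 0 ∧ q • f ∈ W}
  zero_mem' := ⟨1, one_ne_zero, by simp⟩
  add_mem' := by
    rintro f g ⟨p, hp, hf⟩ ⟨q, hq, hg⟩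
    refine ⟨p * q, mul_ne_zero hp hq, ?_⟩
    rw [smul_add, mul_comm, mul_smul, mul_comm, mul_smul]
    exact W.add_mem (W.smul_mem _ hf) (W.smul_mem _ hg)
  smul_mem' := by
    rintro p f ⟨q, hq, hf⟩
    refine ⟨q, hq, ?_⟩
    rw [smul_comm]
    exact W.smul_mem _ hf

theorem le_sat (W : Submodule (MvPolynomial (Fin n) ℂ) (LatFun n)) : W ≤ sat W :=
  fun f hf => ⟨1, one_ne_zero, by simpa using hf⟩

theorem mem_sat_of_smul_mem {W : Submodule (MvPolynomial (Fin n) ℂ) (LatFun n)} {f : LatFun n}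
    {q : MvPolynomial (Fin n) ℂ} (hq : q ≠ 0) (h : q • f ∈ sat W) : f ∈ sat W := by
  obtain ⟨p, hp, h⟩ := h
  exact ⟨p * q, mul_ne_zero hp hq, by rwa [mul_smul]⟩

theorem exists_vec_sub (u : Fin n → ℤ) : ∃ d e : Fin n →₀ ℕ, vec d - vec e = u :=
  ⟨Finsupp.equivFunOnFinite.symm fun i => (u i).toNat,
    Finsupp.equivFunOnFinite.symm fun i => (-u i).toNat, by
      funext i; simp⟩

theorem mem_sat_of_shift_mem {W : Submodule (MvPolynomial (Fin n) ℂ) (LatFun n)} {f : LatFun n}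
    (u : Fin n → ℤ) (h : shift u f ∈ sat W) : f ∈ sat W := by
  obtain ⟨d, e, rfl⟩ := exists_vec_sub u
  refine mem_sat_of_smul_mem (q := MvPolynomial.monomial d 1) (by simp) ?_
  convert (sat W).smul_mem (MvPolynomial.monomial e 1) h using 1
  ext a
  simp only [monomial_smul_apply, shift_apply]
  congr 2; abel

/-- With `u = d - e`, the Laurent polynomial `1 - x^u` becomes the nonzero polynomial `x^e - x^d`
after multiplication by `x^e`. -/
theorem mem_sat_of_sub_shift_mem {W : Submodule (MvPolynomial (Fin n) ℂ) (LatFun n)} {f : LatFun n}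
    {u : Fin n → ℤ} (hu : u ≠ 0) (h : f - shift u f ∈ sat W) : f ∈ sat W := by
  obtain ⟨d, e, rfl⟩ := exists_vec_sub u
  have hde : e ≠ d := by rintro rfl; simp at hu
  refine mem_sat_of_smul_mem
    (q := MvPolynomial.monomial e 1 - MvPolynomial.monomial d 1) ?_ ?_
  · intro h0
    have := congrArg (MvPolynomial.coeff d) h0
    simp [MvPolynomial.coeff_monomial, hde] at this
  · convert (sat W).smul_mem (MvPolynomial.monomial e 1) h using 1
    ext a
    simp only [monomial_smul_apply, shift_apply, sub_smul, sub_apply]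
    rw [sub_sub, add_sub_cancel]
    ring

theorem finite_support_mem_sat {f : LatFun n} (hf : (Function.support f).Finite) :
    f ∈ sat (MvPolynomial (Fin n) ℂ ∙ (one : LatFun n)) := by
  have : f = ∑ a ∈ hf.toFinset, f a • shift a one := by
    ext b
    rw [sum_apply]
    simp only [smul_apply, shift_apply, one, sub_eq_zero, mul_ite, mul_one, mul_zero]
    rw [Finset.sum_ite_eq]
    simp only [Set.Finite.mem_toFinset, Function.mem_support, ite_not]
    split_ifs with h
    · exact h
    · rfl
  rw [this]
  refine Submodule.sum_mem _ fun a _ => mem_of_mem_smul _ (mem_sat_of_shift_mem (-a) ?_) _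
  convert le_sat _ (Submodule.mem_span_singleton_self (one : LatFun n)) using 1
  ext b
  simp

end LatFun

open LatFun

/-! ### Sign cells of the solution lattice and sign flips -/

section Cells

variable {r n : ℕ}

/-- The indicator function of the solutions of `A α = 0` with prescribed signs at the indices
in `M`, where `true` stands for `0 ≤ α i` and `false` for `α i < 0`. -/
def cell (A : Matrix (Fin r) (Fin n) ℤ) (M : Finset (Fin n)) (s : Fin n → Bool) : LatFun n :=
  fun α => if A *ᵥ α = 0 ∧ ∀ i ∈ M, (0 ≤ α i ↔ s i = true) then 1 else 0

/-- Reverse the signs at the indices in `K`. -/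
def flipSigns (K : Finset (Fin n)) (s : Fin n → Bool) : Fin n → Bool :=
  fun i => if i ∈ K then !s i else s i

theorem flipSigns_insert {K : Finset (Fin n)} {i : Fin n} (hi : i ∉ K) (s : Fin n → Bool) :
    flipSigns (insert i K) s = flipSigns {i} (flipSigns K s) := by
  funext j
  by_cases h : j = i
  · subst h; simp [flipSigns, hi]
  · simp [flipSigns, h]

variable (A : Matrix (Fin r) (Fin n) ℤ)

theorem cell_congr {M : Finset (Fin n)} {s t : Fin n → Bool} (h : ∀ i ∈ M, s i = t i) :
    cell A M s = cell A M t := by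
  ext α
  have : (∀ i ∈ M, (0 ≤ α i ↔ s i = true)) ↔ ∀ i ∈ M, (0 ≤ α i ↔ t i = true) :=
    forall₂_congr fun i hi => by rw [h i hi]
  simp only [cell, this]

theorem cell_add_cell_flip {M : Finset (Fin n)} {i : Fin n} (hi : i ∈ M) (s : Fin n → Bool) :
    cell A M s + cell A M (flipSigns {i} s) = cell A (M.erase i) s := by
  ext α
  have h1 : ∀ t : Fin n → Bool, (∀ j ∈ M, (0 ≤ α j ↔ t j = true)) ↔
      (0 ≤ α i ↔ t i = true) ∧ ∀ j ∈ M.erase i, (0 ≤ α j ↔ t j = true) := fun t => by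
    conv_lhs => rw [← Finset.insert_erase hi, Finset.forall_mem_insert]
  have h2 : (∀ j ∈ M.erase i, (0 ≤ α j ↔ flipSigns {i} s j = true)) ↔
      ∀ j ∈ M.erase i, (0 ≤ α j ↔ s j = true) :=
    forall₂_congr fun j hj => by simp [flipSigns, Finset.ne_of_mem_erase hj]
  have h3 : flipSigns {i} s i = !s i := by simp [flipSigns]
  simp only [cell, add_apply, h1, h2, h3]
  by_cases hA : A *ᵥ α = 0 <;> by_cases hE : ∀ j ∈ M.erase i, (0 ≤ α j ↔ s j = true) <;>
    by_cases h0 : 0 ≤ α i <;> cases hs : s i <;> simp [hA, h0]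

theorem cell_eq_zero {M : Finset (Fin n)} {s : Fin n → Bool}
    (h : ∀ α, A *ᵥ α = 0 → ∃ i ∈ M, ¬ (0 ≤ α i ↔ s i = true)) : cell A M s = 0 := by
  ext α
  simp only [cell, zero_apply, ite_eq_right_iff, one_ne_zero, imp_false]
  rintro ⟨h0, h1⟩
  obtain ⟨i, hi, h2⟩ := h α h0
  exact h2 (h1 i hi)

/-- The difference of a cell and a multiple of the opposite cell. -/
def cellDiff (c : ℂ) (M : Finset (Fin n)) (s : Fin n → Bool) : LatFun n :=
  cell A M s - c • cell A M (fun i => !s i)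

theorem cellDiff_congr (c : ℂ) {M : Finset (Fin n)} {s t : Fin n → Bool}
    (h : ∀ i ∈ M, s i = t i) : cellDiff A c M s = cellDiff A c M t := by
  have h' : cell A M (fun i => !s i) = cell A M fun i => !t i :=
    cell_congr A fun i hi => by rw [h i hi]
  rw [cellDiff, cellDiff, cell_congr A h, h']

theorem cellDiff_add_cellDiff_flip (c : ℂ) {M : Finset (Fin n)} {i : Fin n} (hi : i ∈ M)
    (s : Fin n → Bool) :
    cellDiff A c M s + cellDiff A c M (flipSigns {i} s) = cellDiff A c (M.erase i) s := by
  have h : (fun j => !flipSigns {i} s j) = flipSigns {i} fun j => !s j := by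
    funext j
    by_cases hj : j = i <;> simp [flipSigns, hj]
  rw [cellDiff, cellDiff, cellDiff, h, ← cell_add_cell_flip A hi, ← cell_add_cell_flip A hi]
  module

variable {A} {S : Submodule (MvPolynomial (Fin n) ℂ) (LatFun n)} {c : ℂ} {M : Finset (Fin n)}

/-- Modulo smaller sets of conditions, each single flip changes the sign of `cellDiff`; the flips in
`K` are made one at a time. -/
theorem cellDiff_sub_flip_mem (h : ∀ s, ∀ i ∈ M, cellDiff A c (M.erase i) s ∈ S)
    (s : Fin n → Bool) {K : Finset (Fin n)} (hK : K ⊆ M) :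
    cellDiff A c M s - (-1 : ℂ) ^ K.card • cellDiff A c M (flipSigns K s) ∈ S := by
  induction K using Finset.induction_on with
  | empty =>
    have : flipSigns ∅ s = s := by funext j; simp [flipSigns]
    simp [this]
  | insert i K hi ih =>
    have h1 := ih ((Finset.subset_insert i K).trans hK)
    have h2 := h (flipSigns K s) i (hK (Finset.mem_insert_self i K))
    rw [← cellDiff_add_cellDiff_flip A c (hK (Finset.mem_insert_self i K)),
      ← flipSigns_insert hi] at h2
    convert S.add_mem h1 (mem_of_mem_smul S h2 ((-1) ^ K.card)) using 1
    rw [Finset.card_insert_of_notMem hi, pow_succ]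
    module

/-- Any two patterns on `M` differ by flips at the indices where they disagree, so one convenient
pattern `t` settles all of them. -/
theorem cellDiff_mem_of_mem (h : ∀ s, ∀ i ∈ M, cellDiff A c (M.erase i) s ∈ S)
    {t : Fin n → Bool} (ht : cellDiff A c M t ∈ S) (s : Fin n → Bool) : cellDiff A c M s ∈ S := by
  have h1 := cellDiff_sub_flip_mem h s (Finset.filter_subset (fun i => s i ≠ t i) M)
  rw [cellDiff_congr A c (s := flipSigns _ s) (t := t)] at h1
  · exact (S.sub_mem_iff_left (mem_of_mem_smul S ht _)).1 h1
  · intro i hi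
    by_cases hs : s i = t i
    · simp [flipSigns, hs]
    · have : s i = !t i := by cases h1 : s i <;> cases h2 : t i <;> simp_all
      simp [flipSigns, hi, this]

/-- For a coordinate system on the solution space, the opposite cells agree up to torsion. -/
theorem cellDiff_mem_of_card (h : ∀ s, ∀ i ∈ M, cellDiff A ((-1) ^ M.card) (M.erase i) s ∈ S)
    (s : Fin n → Bool) : cellDiff A ((-1) ^ M.card) M s ∈ S := by
  have h1 := cellDiff_sub_flip_mem h s subset_rfl
  rw [cellDiff_congr A _ (s := flipSigns M s) (t := fun i => !s i)
    fun i hi => by simp [flipSigns, hi]] at h1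
  -- As `c = (-1) ^ M.card` satisfies `c * c = 1`, passing to the opposite pattern multiplies
  -- `cellDiff` by `-c`. The full flip thus yields twice the element, and `2` is invertible.
  have h2 : cellDiff A ((-1) ^ M.card) M s -
      (-1 : ℂ) ^ M.card • cellDiff A ((-1) ^ M.card) M (fun i => !s i) =
      (2 : ℂ) • cellDiff A ((-1) ^ M.card) M s := by
    have : ((-1 : ℂ) ^ M.card) * (-1) ^ M.card = 1 := by
      rw [← mul_pow]; simp
    simp only [cellDiff, Bool.not_not, smul_sub, smul_smul, this]
    module
  rw [h2] at h1
  simpa [smul_smul] using mem_of_mem_smul S h1 (2⁻¹ : ℂ)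

/-- Translation by `u` preserves both the equations and the sign conditions on `M`, so `1 - x^u`
annihilates the cells. -/
theorem cellDiff_mem_sat_of_ker {W : Submodule (MvPolynomial (Fin n) ℂ) (LatFun n)}
    {u : Fin n → ℤ} (hu : u ≠ 0) (hA : A *ᵥ u = 0) (hM : ∀ i ∈ M, u i = 0) (s : Fin n → Bool) :
    cellDiff A c M s ∈ sat W := by
  have key : ∀ t, shift u (cell A M t) = cell A M t := fun t => by
    ext α
    have : (∀ i ∈ M, (0 ≤ (α - u) i ↔ t i = true)) ↔ ∀ i ∈ M, (0 ≤ α i ↔ t i = true) :=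
      forall₂_congr fun i hi => by simp [hM i hi]
    simp only [shift_apply, cell, Matrix.mulVec_sub, hA, sub_zero, this]
  refine mem_sat_of_sub_shift_mem hu ?_
  rw [cellDiff, map_sub, map_smul, key, key, sub_self]
  exact Submodule.zero_mem _

theorem cellDiff_mem_of_relation (hv : ∃ v : Fin n → ℤ, (∀ i, 0 < v i) ∧ A *ᵥ v = 0)
    {b : Fin n → ℚ} (hb : ∃ i ∈ M, b i ≠ 0)
    (hrel : ∀ α : Fin n → ℤ, A *ᵥ α = 0 → ∑ i ∈ M, b i * α i = 0)
    (h : ∀ s, ∀ i ∈ M, cellDiff A c (M.erase i) s ∈ S)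
    (s : Fin n → Bool) : cellDiff A c M s ∈ S := by
  obtain ⟨v, hv0, hv⟩ := hv
  -- Evaluated at the positive solution `v`, a nontrivial relation with coefficients of one sign
  -- could not vanish.
  have hex : (∃ i ∈ M, 0 < b i) ∧ ∃ i ∈ M, b i < 0 := by
    have h0 := hrel v hv
    have hvq : ∀ i, (0 : ℚ) < v i := fun i => by exact_mod_cast hv0 i
    obtain ⟨i, hi, hbi⟩ := hb
    constructor
    · by_contra! hn
      have := (Finset.sum_eq_zero_iff_of_nonpos
        fun j hj => mul_nonpos_of_nonpos_of_nonneg (hn j hj) (hvq j).le).1 h0 i hi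
      exact (mul_ne_zero hbi (hvq i).ne') this
    · by_contra! hn
      have := (Finset.sum_eq_zero_iff_of_nonneg
        fun j hj => mul_nonneg (hn j hj) (hvq j).le).1 h0 i hi
      exact (mul_ne_zero hbi (hvq i).ne') this
  obtain ⟨⟨p, hpM, hp⟩, q, hqM, hq⟩ := hex
  -- For the sign pattern of `b` all terms `b i * α i` are nonnegative, and for the opposite pattern
  -- nonpositive, so each term is zero. Because `0` counts as nonnegative, the contradiction comes
  -- from an index whose pattern demands `α i < 0`: `q` for this cell, `p` for the opposite one.
  refine cellDiff_mem_of_mem h (t := fun i => decide (0 ≤ b i)) ?_ s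
  have h1 : cell A M (fun i => decide (0 ≤ b i)) = 0 := by
    refine cell_eq_zero A fun α hα => ?_
    by_contra! hn
    have hpos : ∀ i ∈ M, 0 ≤ b i * α i := fun i hi => by
      have := hn i hi
      simp only [decide_eq_true_eq] at this
      rcases le_or_gt 0 (b i) with h | h
      · exact mul_nonneg h (by exact_mod_cast this.2 h)
      · have : α i < 0 := by by_contra! h'; exact absurd (this.1 h') (not_le.2 h)
        exact mul_nonneg_of_nonpos_of_nonpos h.le (by exact_mod_cast this.le)
    have h0 := (Finset.sum_eq_zero_iff_of_nonneg hpos).1 (hrel α hα) q hqM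
    have hαq : α q = 0 := by
      rcases mul_eq_zero.1 h0 with h | h
      · exact absurd h hq.ne
      · exact_mod_cast h
    have := (hn q hqM).1 hαq.ge
    simp only [decide_eq_true_eq] at this
    exact absurd this (not_le.2 hq)
  have h2 : cell A M (fun i => !decide (0 ≤ b i)) = 0 := by
    refine cell_eq_zero A fun α hα => ?_
    by_contra! hn
    have hneg : ∀ i ∈ M, b i * α i ≤ 0 := fun i hi => by
      have := hn i hi
      simp only [Bool.not_eq_true', decide_eq_false_iff_not, not_le] at this
      rcases le_or_gt 0 (b i) with h | h
      · have : α i < 0 := by by_contra! h'; exact absurd (this.1 h') (not_lt.2 h)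
        exact mul_nonpos_of_nonneg_of_nonpos h (by exact_mod_cast this.le)
      · exact mul_nonpos_of_nonpos_of_nonneg h.le (by exact_mod_cast this.2 h)
    have h0 := (Finset.sum_eq_zero_iff_of_nonpos hneg).1 (hrel α hα) p hpM
    have hαp : α p = 0 := by
      rcases mul_eq_zero.1 h0 with h | h
      · exact absurd h hp.ne'
      · exact_mod_cast h
    have := (hn p hpM).1 hαp.ge
    simp only [Bool.not_eq_true', decide_eq_false_iff_not, not_le] at this
    exact absurd this hp.not_gt
  rw [cellDiff, h1, h2]
  simp

/-- The cone of a coordinate system on the solution space is summable. -/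
theorem cell_true_mem_sat_of_dual
    (hinj : ∀ u : Fin n → ℤ, A *ᵥ u = 0 → (∀ i ∈ M, u i = 0) → u = 0)
    (hdual : ∀ i ∈ M, ∃ u : Fin n → ℤ, A *ᵥ u = 0 ∧ 0 < u i ∧ ∀ j ∈ M, j ≠ i → u j = 0) :
    cell A M (fun _ => true) ∈ sat (MvPolynomial (Fin n) ℂ ∙ (one : LatFun n)) := by
  classical
  choose! u hu using hdual
  -- Multiplication by `1 - x^(u i)` truncates the cone to `α i < u i i` and leaves the other
  -- coordinates in `M` alone. Truncating in all directions of `M` leaves a finite fundamental box,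
  -- since the coordinates in `M` determine a solution.
  let box (K : Finset (Fin n)) : LatFun n := fun α =>
    if A *ᵥ α = 0 ∧ (∀ i ∈ M, 0 ≤ α i) ∧ ∀ i ∈ K, α i < u i i then 1 else 0
  have hfin : (Function.support (box M)).Finite := by
    refine Set.Finite.of_finite_image (f := fun (α : Fin n → ℤ) (i : M) => α i)
      ((Set.finite_Icc (0 : M → ℤ) fun i => u i i).subset ?_) ?_
    · rintro _ ⟨α, hα, rfl⟩
      simp only [box, Function.mem_support, ne_eq, ite_eq_right_iff, one_ne_zero, imp_false,
        not_not] at hα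
      exact ⟨fun i => hα.2.1 i i.2, fun i => (hα.2.2 i i.2).le⟩
    · intro α hα β hβ hαβ
      simp only [box, Function.mem_support, ne_eq, ite_eq_right_iff, one_ne_zero, imp_false,
        not_not] at hα hβ
      refine sub_eq_zero.1 (hinj _ (by rw [Matrix.mulVec_sub, hα.1, hβ.1, sub_zero]) fun i hi => ?_)
      exact sub_eq_zero.2 (congrFun hαβ ⟨i, hi⟩)
  have hstep : ∀ K ⊆ M, ∀ i ∈ M, i ∉ K → box K - shift (u i) (box K) = box (insert i K) := by
    intro K hK i hi hiK
    obtain ⟨h1, h2, h3⟩ := hu i hi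
    ext α
    have e1 : (∀ j ∈ M, 0 ≤ (α - u i) j) ↔ u i i ≤ α i ∧ ∀ j ∈ M.erase i, 0 ≤ α j := by
      conv_lhs => rw [← Finset.insert_erase hi, Finset.forall_mem_insert]
      refine and_congr (by simp) (forall₂_congr fun j hj => ?_)
      simp [h3 j (Finset.mem_of_mem_erase hj) (Finset.ne_of_mem_erase hj)]
    have e2 : (∀ j ∈ M, 0 ≤ α j) ↔ 0 ≤ α i ∧ ∀ j ∈ M.erase i, 0 ≤ α j := by
      conv_lhs => rw [← Finset.insert_erase hi, Finset.forall_mem_insert]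
    have e3 : (∀ j ∈ K, (α - u i) j < u j j) ↔ ∀ j ∈ K, α j < u j j :=
      forall₂_congr fun j hj => by
        simp [h3 j (hK hj) (fun e => hiK (e ▸ hj))]
    simp only [box, sub_apply, shift_apply, Matrix.mulVec_sub, h1, sub_zero, e1, e2, e3,
      Finset.forall_mem_insert]
    by_cases a1 : A *ᵥ α = 0 <;> by_cases a2 : ∀ j ∈ M.erase i, 0 ≤ α j <;>
      by_cases a3 : ∀ j ∈ K, α j < u j j <;> simp only [a1, a2, a3, true_and, false_and,
        and_false, if_false, sub_zero]
    rcases lt_or_ge (α i) (u i i) with h | h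
    · simp [h, not_le.2 h]
    · simp [h, not_lt.2 h, h2.le.trans h]
  -- The truncations are undone one at a time, from the finite `box M` back to the whole cone `box
  -- ∅`.
  have hall : ∀ K ⊆ M, box (M \ K) ∈ sat (MvPolynomial (Fin n) ℂ ∙ (one : LatFun n)) := by
    intro K
    induction K using Finset.induction_on with
    | empty => intro _; simpa using finite_support_mem_sat hfin
    | insert i K hi ih =>
      intro hK
      have hiM := hK (Finset.mem_insert_self i K)
      refine mem_sat_of_sub_shift_mem (u := u i) ?_ ?_
      · intro h0
        have := (hu i hiM).2.1
        simp [h0] at this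
      · rw [hstep _ Finset.sdiff_subset i hiM (by simp)]
        convert ih ((Finset.subset_insert i K).trans hK) using 2
        ext j
        by_cases hj : j = i
        · subst hj; simp [hi, hiM]
        · simp [hj]
  convert hall M subset_rfl using 1
  ext α
  simp [cell, box]

end Cells

/-! ### Coordinates on the solution space and the main induction -/

section SolutionSpace

variable {r n : ℕ}

theorem exists_int_multiple (v : Fin n → ℚ) :
    ∃ k : ℤ, 0 < k ∧ ∃ u : Fin n → ℤ, ∀ i, (u i : ℚ) = k * v i := by
  refine ⟨∏ i, ((v i).den : ℤ), Finset.prod_pos fun i _ => by exact_mod_cast (v i).pos,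
    fun i => (∏ j ∈ Finset.univ.erase i, ((v j).den : ℤ)) * (v i).num, fun i => ?_⟩
  rw [← Finset.mul_prod_erase _ _ (Finset.mem_univ i)]
  push_cast
  have := Rat.mul_den_eq_num (v i)
  rw [← this]
  ring

theorem mulVec_cast_eq_zero_iff (A : Matrix (Fin r) (Fin n) ℤ) (u : Fin n → ℤ) :
    A.map (Int.cast : ℤ → ℚ) *ᵥ (fun i => (u i : ℚ)) = 0 ↔ A *ᵥ u = 0 := by
  simp only [funext_iff, Matrix.mulVec, dotProduct, Matrix.map_apply, Pi.zero_apply]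
  exact forall_congr' fun j => by exact_mod_cast Iff.rfl

theorem rk_le (A : Matrix (Fin r) (Fin n) ℤ) : rk A ≤ n := by
  exact (A.map (Int.cast : ℤ → ℚ)).rank_le_width

theorem finrank_ker_eq (A : Matrix (Fin r) (Fin n) ℤ) :
    Module.finrank ℚ (LinearMap.ker (A.map (Int.cast : ℤ → ℚ)).mulVecLin) = n - rk A := by
  have h := LinearMap.finrank_range_add_finrank_ker (A.map (Int.cast : ℤ → ℚ)).mulVecLin
  rw [Module.finrank_fin_fun] at h
  rw [rk, Matrix.rank]
  omega

/-- The restriction of the solution space of `A α = 0` to the coordinates in `M` is not injective,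
or not surjective, or bijective. -/
theorem solution_space_trichotomy (A : Matrix (Fin r) (Fin n) ℤ) (M : Finset (Fin n)) :
    (∃ u : Fin n → ℤ, u ≠ 0 ∧ A *ᵥ u = 0 ∧ ∀ i ∈ M, u i = 0) ∨
    (∃ b : Fin n → ℚ, (∃ i ∈ M, b i ≠ 0) ∧
      ∀ α : Fin n → ℤ, A *ᵥ α = 0 → ∑ i ∈ M, b i * α i = 0) ∨
    (M.card = n - rk A ∧
      (∀ u : Fin n → ℤ, A *ᵥ u = 0 → (∀ i ∈ M, u i = 0) → u = 0) ∧
      ∀ i ∈ M, ∃ u : Fin n → ℤ, A *ᵥ u = 0 ∧ 0 < u i ∧ ∀ j ∈ M, j ≠ i → u j = 0) := by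
  classical
  by_cases hinj : ∀ u : Fin n → ℤ, A *ᵥ u = 0 → (∀ i ∈ M, u i = 0) → u = 0
  swap
  · left
    push Not at hinj
    obtain ⟨u, h1, h2, h3⟩ := hinj
    exact ⟨u, h3, h1, h2⟩
  right
  let V := LinearMap.ker (A.map (Int.cast : ℤ → ℚ)).mulVecLin
  let π : V →ₗ[ℚ] (M → ℚ) := (LinearMap.funLeft ℚ ℚ (Subtype.val : M → Fin n)).comp V.subtype
  have hint : ∀ v : V, ∃ k : ℤ, 0 < k ∧ ∃ u : Fin n → ℤ, A *ᵥ u = 0 ∧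
      ∀ i, (u i : ℚ) = k * v.1 i := fun v => by
    obtain ⟨k, hk, u, hu⟩ := exists_int_multiple v.1
    refine ⟨k, hk, u, ?_, hu⟩
    rw [← mulVec_cast_eq_zero_iff]
    have : (fun i => (u i : ℚ)) = (k : ℚ) • v.1 := funext hu
    rw [this, Matrix.mulVec_smul]
    have hv : A.map (Int.cast : ℤ → ℚ) *ᵥ v.1 = 0 := v.2
    rw [hv, smul_zero]
  by_cases hsurj : Function.Surjective π
  · right
    refine ⟨?_, hinj, fun i hi => ?_⟩
    · have hπ : Function.Injective π := by
        rw [injective_iff_map_eq_zero]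
        intro v hv
        obtain ⟨k, hk, u, hu, huv⟩ := hint v
        have hkq : (k : ℚ) ≠ 0 := by exact_mod_cast hk.ne'
        have h0 := hinj u hu fun i hi => by
          have h1 : v.1 i = 0 := congrFun hv ⟨i, hi⟩
          have h2 := huv i
          rw [h1, mul_zero] at h2
          exact_mod_cast h2
        ext i
        have h2 := huv i
        rw [h0] at h2
        simpa [hkq] using h2.symm
      have := (LinearEquiv.ofBijective π ⟨hπ, hsurj⟩).finrank_eq
      rw [finrank_ker_eq] at this
      simpa using this.symm
    · obtain ⟨v, hv⟩ := hsurj (Pi.single ⟨i, hi⟩ 1)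
      obtain ⟨k, hk, u, hu, huv⟩ := hint v
      refine ⟨u, hu, ?_, fun j hj hji => ?_⟩
      · have h1 : v.1 i = 1 := by
          have := congrFun hv ⟨i, hi⟩
          rwa [Pi.single_eq_same] at this
        have h2 := huv i
        rw [h1, mul_one] at h2
        have : u i = k := by exact_mod_cast h2
        rwa [this]
      · have h1 : v.1 j = 0 := by
          have := congrFun hv ⟨j, hj⟩
          rwa [Pi.single_eq_of_ne (by simpa using hji)] at this
        have h2 := huv j
        rw [h1, mul_zero] at h2
        exact_mod_cast h2
  · left
    have hlt : LinearMap.range π < ⊤ := lt_top_iff_ne_top.2 fun h => hsurj (LinearMap.range_eq_top.1 h)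
    -- A nonzero functional vanishing on the proper subspace `range π` is a linear relation; its
    -- values on the unit vectors are the coefficients `b`.
    obtain ⟨f, hf, hle⟩ := Submodule.exists_le_ker_of_lt_top _ hlt
    have hfapp : ∀ w : M → ℚ, f w = ∑ i : M, w i * f (Pi.single i 1) := fun w => by
      conv_lhs => rw [pi_eq_sum_univ' w, map_sum]
      refine Finset.sum_congr rfl fun i _ => ?_
      rw [map_smul, smul_eq_mul]
    let b : Fin n → ℚ := fun i => if h : i ∈ M then f (Pi.single ⟨i, h⟩ 1) else 0
    have hb : ∀ i : M, b i = f (Pi.single i 1) := fun i => dif_pos i.2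
    refine ⟨b, ?_, fun α hα => ?_⟩
    · by_contra! hn
      refine hf (LinearMap.ext fun w => ?_)
      rw [hfapp, LinearMap.zero_apply]
      exact Finset.sum_eq_zero fun i _ => by rw [← hb, hn i i.2, mul_zero]
    · have h1 : f (π ⟨fun i => (α i : ℚ), (mulVec_cast_eq_zero_iff A α).2 hα⟩) = 0 :=
        hle (LinearMap.mem_range_self _ _)
      rw [hfapp] at h1
      rw [← h1, ← Finset.sum_coe_sort]
      exact Finset.sum_congr rfl fun i _ => by rw [hb, mul_comm]; rfl

variable {A : Matrix (Fin r) (Fin n) ℤ}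

/-- Induction over the set of sign conditions: a statement about opposite cells holds modulo a
saturated submodule if it holds for the coordinate systems of the solution space. -/
theorem cellDiff_mem_sat (hv : ∃ v : Fin n → ℤ, (∀ i, 0 < v i) ∧ A *ᵥ v = 0)
    (W : Submodule (MvPolynomial (Fin n) ℂ) (LatFun n)) (c : ℂ)
    (hbase : ∀ M : Finset (Fin n), M.card = n - rk A →
      (∀ u : Fin n → ℤ, A *ᵥ u = 0 → (∀ i ∈ M, u i = 0) → u = 0) →
      (∀ i ∈ M, ∃ u : Fin n → ℤ, A *ᵥ u = 0 ∧ 0 < u i ∧ ∀ j ∈ M, j ≠ i → u j = 0) →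
      (∀ s, ∀ i ∈ M, cellDiff A c (M.erase i) s ∈ sat W) → ∀ s, cellDiff A c M s ∈ sat W)
    (M : Finset (Fin n)) (s : Fin n → Bool) : cellDiff A c M s ∈ sat W := by
  induction M using Finset.strongInduction generalizing s with
  | H M ih =>
    have ih' : ∀ s, ∀ i ∈ M, cellDiff A c (M.erase i) s ∈ sat W :=
      fun s i hi => ih _ (Finset.erase_ssubset hi) s
    rcases solution_space_trichotomy A M with ⟨u, hu, hA, hM⟩ | ⟨b, hb, hrel⟩ | ⟨h1, h2, h3⟩
    · exact cellDiff_mem_sat_of_ker hu hA hM s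
    · exact cellDiff_mem_of_relation hv hb hrel ih' s
    · exact hbase M h1 h2 h3 ih' s

/-- Cells are summable. -/
theorem cell_mem_sat (hv : ∃ v : Fin n → ℤ, (∀ i, 0 < v i) ∧ A *ᵥ v = 0)
    (M : Finset (Fin n)) (s : Fin n → Bool) :
    cell A M s ∈ sat (MvPolynomial (Fin n) ℂ ∙ (one : LatFun n)) := by
  -- With `c = 0` the induction on `cellDiff` speaks about single cells, and only the
  -- all-nonnegative cone needs to be summed directly.
  have h0 : ∀ M s, cellDiff A 0 M s = cell A M s := fun M s => by simp [cellDiff]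
  rw [← h0]
  refine cellDiff_mem_sat hv _ 0 (fun M _ hinj hdual ih => ?_) M s
  refine cellDiff_mem_of_mem ih (t := fun _ => true) ?_
  rw [h0]
  exact cell_true_mem_sat_of_dual hinj hdual

/-- Reciprocity: opposite cells agree up to sign and torsion. -/
theorem cellDiff_mem_torsion (hv : ∃ v : Fin n → ℤ, (∀ i, 0 < v i) ∧ A *ᵥ v = 0)
    (M : Finset (Fin n)) (s : Fin n → Bool) :
    cellDiff A ((-1) ^ (n - rk A)) M s ∈ sat ⊥ := by
  refine cellDiff_mem_sat hv _ _ (fun M hM _ _ ih => ?_) M s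
  rw [← hM] at ih ⊢
  exact cellDiff_mem_of_card ih

end SolutionSpace

/-! ### Rational sums of formal Laurent series -/

section Represents

variable {n : ℕ}

/-- The formal Laurent series `f` sums to the rational function `F`. -/
def Represents (f : LatFun n) (F : RatFun (Fin n)) : Prop :=
  ∃ p q : MvPolynomial (Fin n) ℂ, q ≠ 0 ∧ q • f = p • one ∧
    F = algebraMap _ (RatFun (Fin n)) p / algebraMap _ (RatFun (Fin n)) q

theorem algebraMap_ratFun_ne_zero {q : MvPolynomial (Fin n) ℂ} (hq : q ≠ 0) :
    algebraMap _ (RatFun (Fin n)) q ≠ 0 :=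
  (map_ne_zero_iff _ (IsFractionRing.injective _ _)).2 hq

theorem exists_represents {f : LatFun n}
    (hf : f ∈ sat (MvPolynomial (Fin n) ℂ ∙ (one : LatFun n))) : ∃ F, Represents f F := by
  obtain ⟨q, hq, h⟩ := hf
  obtain ⟨p, hp⟩ := Submodule.mem_span_singleton.1 h
  exact ⟨_, p, q, hq, hp.symm, rfl⟩

/-- Over the common denominator `q * q'`, the cross-multiplied difference of the fractions, times a
torsion multiplier `t`, kills the series `1`, hence is zero. -/
theorem Represents.eq_mul {f g : LatFun n} {F G : RatFun (Fin n)} (hf : Represents f F)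
    (hg : Represents g G) {c : ℂ} (h : f - c • g ∈ sat (⊥ : Submodule (MvPolynomial (Fin n) ℂ) _)) :
    F = algebraMap _ _ (MvPolynomial.C c : MvPolynomial (Fin n) ℂ) * G := by
  obtain ⟨p, q, hq, hpq, rfl⟩ := hf
  obtain ⟨p', q', hq', hpq', rfl⟩ := hg
  obtain ⟨t, ht, h⟩ := h
  rw [Submodule.mem_bot] at h
  have h1 : (t * (q' * p - q * MvPolynomial.C c * p')) • (one : LatFun n) = 0 := by
    have e1 : (q' * p) • (one : LatFun n) = (q * q') • f := by
      rw [mul_smul, ← hpq, ← mul_smul, mul_comm]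
    have e2 : (q * MvPolynomial.C c * p') • (one : LatFun n) = (q * q') • (c • g) := by
      rw [mul_smul, ← hpq', ← C_smul, ← mul_smul, ← mul_smul]
      congr 1; ring
    rw [mul_smul, sub_smul, e1, e2, ← smul_sub, smul_comm, h, smul_zero]
  have h2 := (mul_eq_zero.1 (eq_zero_of_poly_smul_one h1)).resolve_left ht
  have h3 := congrArg (algebraMap _ (RatFun (Fin n))) (sub_eq_zero.1 h2)
  simp only [map_mul] at h3
  have := algebraMap_ratFun_ne_zero hq
  have := algebraMap_ratFun_ne_zero hq'
  field_simp
  linear_combination h3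

theorem Represents.smul {f : LatFun n} {F : RatFun (Fin n)} (hf : Represents f F) (c : ℂ) :
    Represents (c • f) (algebraMap _ _ (MvPolynomial.C c : MvPolynomial (Fin n) ℂ) * F) := by
  obtain ⟨p, q, hq, hpq, rfl⟩ := hf
  refine ⟨MvPolynomial.C c * p, q, hq, ?_, by rw [map_mul, mul_div_assoc]⟩
  rw [mul_smul, ← hpq, ← C_smul, smul_comm]

/-- For a series supported in the nonnegative orthant, the lattice action of polynomials is ordinary
multiplication of power series. -/
theorem coeff_coe_mul {f : LatFun n} {g : MvPowerSeries (Fin n) ℂ}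
    (h0 : ∀ d, f (vec d) = MvPowerSeries.coeff d g) (h1 : ∀ a i, a i < 0 → f a = 0)
    (q : MvPolynomial (Fin n) ℂ) (d : Fin n →₀ ℕ) :
    MvPowerSeries.coeff d ((q : MvPowerSeries (Fin n) ℂ) * g) = (q • f) (vec d) := by
  classical
  induction q using MvPolynomial.induction_on' with
  | monomial e c =>
    rw [MvPolynomial.coe_monomial, MvPowerSeries.coeff_monomial_mul, monomial_smul_apply]
    split_ifs with h
    · rw [← h0]
      congr 2
      funext i
      simp [Nat.cast_sub (h i)]
    · obtain ⟨i, hi⟩ := not_forall.1 h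
      rw [h1 _ i, mul_zero]
      simp only [Pi.sub_apply, vec_apply]
      have := not_le.1 hi
      omega
  | add p q hp hq =>
    rw [MvPolynomial.coe_add, add_mul, map_add, hp, hq, add_smul, add_apply]

theorem Represents.isRatFun {f : LatFun n} {F : RatFun (Fin n)} (hf : Represents f F)
    {g : MvPowerSeries (Fin n) ℂ} (h0 : ∀ d, f (vec d) = MvPowerSeries.coeff d g)
    (h1 : ∀ a i, a i < 0 → f a = 0) : IsRatFun g F := by
  obtain ⟨p, q, hq, hpq, rfl⟩ := hf
  have hmap : ∀ p : MvPolynomial (Fin n) ℂ, toSeriesQuot (algebraMap _ (RatFun (Fin n)) p) =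
      algebraMap (MvPowerSeries (Fin n) ℂ) _ (p : MvPowerSeries (Fin n) ℂ) := fun p =>
    by erw [toSeriesQuot, IsLocalization.map_eq]; rfl
  have hq' : algebraMap (MvPowerSeries (Fin n) ℂ) (FractionRing (MvPowerSeries (Fin n) ℂ))
      (q : MvPowerSeries (Fin n) ℂ) ≠ 0 := by
    rw [← hmap]
    exact (map_ne_zero _).2 (algebraMap_ratFun_ne_zero hq)
  rw [IsRatFun, map_div₀, hmap, hmap, eq_div_iff hq', ← map_mul]
  congr 1
  ext d
  rw [mul_comm, coeff_coe_mul h0 h1, hpq, poly_smul_one_vec, MvPolynomial.coeff_coe]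

/-- The Laurent series `f(x⁻¹)`. -/
def reflect (f : LatFun n) : LatFun n := fun a => f (-a)

theorem invVars_monomial (d : Fin n →₀ ℕ) (c : ℂ) :
    algebraMap (MvPolynomial (Fin n) ℂ) (RatFun (Fin n)) (MvPolynomial.monomial d 1) *
      invVars (algebraMap _ _ (MvPolynomial.monomial d c)) =
      algebraMap _ _ (MvPolynomial.C c : MvPolynomial (Fin n) ℂ) := by
  rw [invVars, IsFractionRing.lift_algebraMap, MvPolynomial.coe_eval₂Hom,
    MvPolynomial.eval₂_monomial, MvPolynomial.monomial_eq (a := (1 : ℂ)), map_one, one_mul,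
    Finsupp.prod, Finsupp.prod, map_prod, mul_left_comm, ← Finset.prod_mul_distrib,
    Finset.prod_eq_one, mul_one]
  · rfl
  · intro i _
    rw [map_pow, ← mul_pow]
    change (RatFun.var i * _) ^ _ = _
    have h : RatFun.var i ≠ 0 := algebraMap_ratFun_ne_zero (MvPolynomial.X_ne_zero i)
    rw [mul_inv_cancel₀ h, one_pow]

/-- The substitution `x ↦ x⁻¹` turns a polynomial into a polynomial divided by a monomial. -/
theorem exists_reverse (q : MvPolynomial (Fin n) ℂ) : ∃ (m : Fin n →₀ ℕ)
    (q' : MvPolynomial (Fin n) ℂ),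
    algebraMap (MvPolynomial (Fin n) ℂ) (RatFun (Fin n)) (MvPolynomial.monomial m 1) * invVars (algebraMap _ _ q) =
      algebraMap _ _ q' ∧
    ∀ f : LatFun n, q' • reflect f =
      (MvPolynomial.monomial m 1 : MvPolynomial (Fin n) ℂ) • reflect (q • f) := by
  induction q using MvPolynomial.induction_on' with
  | monomial d c =>
    refine ⟨d, MvPolynomial.C c, invVars_monomial d c, fun f => ?_⟩
    ext a
    rw [C_smul, monomial_smul_apply, one_mul, reflect, monomial_smul_apply, smul_apply, reflect]
    congr 2; abel
  | add p q hp hq =>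
    obtain ⟨m, p', hp1, hp2⟩ := hp
    obtain ⟨k, q', hq1, hq2⟩ := hq
    have hmk : (MvPolynomial.monomial (m + k) 1 : MvPolynomial (Fin n) ℂ) =
        MvPolynomial.monomial m 1 * MvPolynomial.monomial k 1 := by
      rw [MvPolynomial.monomial_mul, one_mul]
    refine ⟨m + k, MvPolynomial.monomial k 1 * p' + MvPolynomial.monomial m 1 * q', ?_, fun f => ?_⟩
    · rw [hmk]
      simp only [map_add, map_mul, ← hp1, ← hq1]
      ring
    · have : reflect ((p + q) • f) = reflect (p • f) + reflect (q • f) := by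
        ext a; simp [reflect, add_smul]
      rw [add_smul, mul_smul, mul_smul, hp2, hq2, this, smul_add, hmk]
      congr 1
      · rw [mul_comm, mul_smul]
      · rw [mul_smul]

theorem Represents.reflect {f : LatFun n} {F : RatFun (Fin n)} (hf : Represents f F) :
    Represents (reflect f) (invVars F) := by
  obtain ⟨p, q, hq, hpq, rfl⟩ := hf
  obtain ⟨m, p', hp1, hp2⟩ := exists_reverse p
  obtain ⟨k, q', hq1, hq2⟩ := exists_reverse q
  have hm : ∀ m : Fin n →₀ ℕ, algebraMap (MvPolynomial (Fin n) ℂ) (RatFun (Fin n)) (MvPolynomial.monomial m 1) ≠ 0 :=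
    fun m => algebraMap_ratFun_ne_zero (by simp)
  have hq0 : invVars (algebraMap _ _ q) ≠ 0 := (map_ne_zero _).2 (algebraMap_ratFun_ne_zero hq)
  have hq' : q' ≠ 0 := by
    rintro rfl
    rw [map_zero] at hq1
    exact mul_ne_zero (hm k) hq0 hq1
  -- Since `p(x⁻¹) = p' / x^m` and `q(x⁻¹) = q' / x^k`, the quotient is `x^k p' / (x^m q')`.
  refine ⟨MvPolynomial.monomial k 1 * p', MvPolynomial.monomial m 1 * q',
    mul_ne_zero (by simp) hq', ?_, ?_⟩
  · have h1 : MNRecip.reflect (one : LatFun n) = one := by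
      ext a; simp [MNRecip.reflect, one]
    have h2 := hp2 one
    rw [h1] at h2
    rw [mul_smul, hq2, hpq, mul_smul, h2, smul_comm]
  · have h1 := hm m
    have h2 := hm k
    rw [map_mul, map_mul, ← hp1, ← hq1, map_div₀]
    field_simp

end Represents

/-! ### From formal sums to Malcev-Neumann expansions -/

section Expansions

variable {r n : ℕ}

/-- The exponents of the `x_i` in a monomial in all variables. -/
def xPart {ρ : Endo (r + n)} (a : Expo ρ) : Fin n → ℤ := fun i => Expo.toVec ρ a (Fin.natAdd r i)

/-- The monomial involves none of the `λ_j`. -/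
def LamFree {ρ : Endo (r + n)} (a : Expo ρ) : Prop := ∀ i ∈ lamVars r n, Expo.toVec ρ a i = 0

theorem lamFree_iff {ρ : Endo (r + n)} (a : Expo ρ) :
    LamFree a ↔ ∀ j : Fin r, Expo.toVec ρ a (Fin.castAdd n j) = 0 := by
  simp [LamFree, lamVars]

theorem polyToMN_monomial {N : ℕ} (ρ : Endo N) (d : Fin N →₀ ℕ) (c : ℂ) :
    polyToMN ρ (MvPolynomial.monomial d c) = HahnSeries.single (natExpo ρ d) c := by
  classical
  have h := eval_single_apply (natExpo ρ) (MvPolynomial.monomial d c)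
  simp only [natExpo_single] at h
  rw [polyToMN, h]
  by_cases hc : c = 0
  · simp [hc]
  · simp [MvPolynomial.support_monomial, hc]

theorem expand_algebraMap {N : ℕ} (ρ : Endo N) (p : MvPolynomial (Fin N) ℂ) :
    expand ρ (algebraMap _ _ p) = polyToMN ρ p :=
  IsFractionRing.lift_algebraMap _ _

theorem inclX_algebraMap (p : MvPolynomial (Fin n) ℂ) :
    inclX r n (algebraMap _ _ p) = algebraMap _ _ (MvPolynomial.rename (Fin.natAdd r) p) := by
  erw [inclX, IsLocalization.map_eq]
  rfl

theorem natExpo_mapDomain_castAdd (ρ : Endo (r + n)) (d : Fin n →₀ ℕ) (j : Fin r) :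
    Expo.toVec ρ (natExpo ρ (d.mapDomain (Fin.natAdd r))) (Fin.castAdd n j) = 0 := by
  change ((d.mapDomain (Fin.natAdd r)) (Fin.castAdd n j) : ℤ) = 0
  rw [Finsupp.mapDomain_of_notMem_range, Nat.cast_zero]
  rintro ⟨i, hi⟩
  have := congrArg Fin.val hi
  simp only [Fin.val_natAdd, Fin.val_castAdd] at this
  omega

theorem xPart_natExpo_mapDomain (ρ : Endo (r + n)) (d : Fin n →₀ ℕ) :
    xPart (natExpo ρ (d.mapDomain (Fin.natAdd r))) = vec d := by
  funext i
  change ((d.mapDomain (Fin.natAdd r)) (Fin.natAdd r i) : ℤ) = d i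
  rw [Finsupp.mapDomain_apply (Fin.natAdd_injective n r)]

theorem coeff_polyToMN_rename_mul {ρ : Endo (r + n)} {H : MNSeries ρ} {f : LatFun n}
    (h1 : ∀ a, LamFree a → H.coeff a = f (xPart a)) (h2 : ∀ a, ¬ LamFree a → H.coeff a = 0)
    (q : MvPolynomial (Fin n) ℂ) :
    (∀ a, LamFree a →
      (polyToMN ρ (MvPolynomial.rename (Fin.natAdd r) q) * H).coeff a = (q • f) (xPart a)) ∧
    ∀ a, ¬ LamFree a → (polyToMN ρ (MvPolynomial.rename (Fin.natAdd r) q) * H).coeff a = 0 := by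
  induction q using MvPolynomial.induction_on' with
  | monomial d c =>
    rw [MvPolynomial.rename_monomial, polyToMN_monomial]
    have hfree : ∀ a, LamFree (a - natExpo ρ (d.mapDomain (Fin.natAdd r))) ↔ LamFree a :=
      fun a => by
        rw [lamFree_iff, lamFree_iff]
        refine forall_congr' fun j => ?_
        rw [map_sub, Pi.sub_apply, natExpo_mapDomain_castAdd, sub_zero]
    constructor
    · intro a ha
      rw [HahnSeries.coeff_single_mul, h1 _ ((hfree a).2 ha), monomial_smul_apply,
        ← xPart_natExpo_mapDomain ρ]
      rfl
    · intro a ha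
      rw [HahnSeries.coeff_single_mul, h2 _ (mt (hfree a).1 ha), mul_zero]
  | add p q hp hq =>
    constructor
    · intro a ha
      rw [map_add, map_add, add_mul, HahnSeries.coeff_add, hp.1 a ha, hq.1 a ha, add_smul,
        add_apply]
    · intro a ha
      rw [map_add, map_add, add_mul, HahnSeries.coeff_add, hp.2 a ha, hq.2 a ha, add_zero]

/-- The relation `q • f = p • one` transfers coefficientwise to `q * H = p` in the field of series,
where `q` can be divided out. The order plays no role beyond the existence of `H`. -/
theorem Represents.expand_inclX {f : LatFun n} {F : RatFun (Fin n)} (hf : Represents f F)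
    {ρ : Endo (r + n)} {H : MNSeries ρ}
    (h1 : ∀ a, LamFree a → H.coeff a = f (xPart a)) (h2 : ∀ a, ¬ LamFree a → H.coeff a = 0) :
    H = expand ρ (inclX r n F) := by
  obtain ⟨p, q, hq, hpq, rfl⟩ := hf
  have hmap : ∀ p : MvPolynomial (Fin n) ℂ, expand ρ (inclX r n (algebraMap _ _ p)) =
      polyToMN ρ (MvPolynomial.rename (Fin.natAdd r) p) := fun p => by
    rw [inclX_algebraMap, expand_algebraMap]
  have hq0 : expand ρ (inclX r n (algebraMap _ _ q)) ≠ 0 :=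
    (map_ne_zero _).2 ((map_ne_zero _).2 (algebraMap_ratFun_ne_zero hq))
  have e1 : ∀ a : Expo ρ, LamFree a → (1 : MNSeries ρ).coeff a = (one : LatFun n) (xPart a) := by
    intro a ha
    have : a = 0 ↔ xPart a = 0 := by
      constructor
      · rintro rfl
        funext i
        simp [xPart]
      · intro h
        refine (Expo.toVec ρ).injective (funext fun k => ?_)
        rw [map_zero]
        refine Fin.addCases (fun j => ?_) (fun i => ?_) k
        · exact (lamFree_iff a).1 ha j
        · exact congrFun h i
    rw [HahnSeries.coeff_one, one]
    simp only [this]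
  have e2 : ∀ a : Expo ρ, ¬ LamFree a → (1 : MNSeries ρ).coeff a = 0 := by
    intro a ha
    rw [HahnSeries.coeff_one, if_neg]
    rintro rfl
    exact ha fun i _ => by simp
  rw [map_div₀, map_div₀, eq_div_iff hq0, hmap, hmap, mul_comm,
    ← mul_one (polyToMN ρ (MvPolynomial.rename (Fin.natAdd r) p))]
  ext a
  by_cases ha : LamFree a
  · rw [(coeff_polyToMN_rename_mul h1 h2 q).1 a ha, (coeff_polyToMN_rename_mul e1 e2 p).1 a ha, hpq]
  · rw [(coeff_polyToMN_rename_mul h1 h2 q).2 a ha, (coeff_polyToMN_rename_mul e1 e2 p).2 a ha]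

end Expansions

/-! ### Products of geometric series -/

section Geometric

theorem sum_add_single_smul {n : ℕ} {Γ : Type} [AddCommMonoid Γ] (w : Fin n → Γ) (α : Fin n → ℕ) (i : Fin n) :
    ∑ j, (α + Pi.single i 1 : Fin n → ℕ) j • w j = ∑ j, α j • w j + w i := by
  simp only [Pi.add_apply, add_smul, Finset.sum_add_distrib]
  congr 1
  rw [Finset.sum_eq_single i]
  · simp
  · intro j _ hj; simp [hj]
  · simp

theorem one_sub_single_ne_zero {Γ : Type} [AddCommGroup Γ] [LinearOrder Γ] {v : Γ} (hv : v ≠ 0) :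
    (1 - HahnSeries.single v 1 : HahnSeries Γ ℂ) ≠ 0 := by
  intro h
  have := congrArg (fun f => HahnSeries.coeff f 0) h
  simp [hv.symm] at this

variable {n : ℕ} {Γ : Type} [AddCommGroup Γ] [LinearOrder Γ] [IsOrderedAddMonoid Γ]

/-- The sum of all monomials with exponents `∑ i ∈ K, α i • w i`, for natural numbers `α i`. -/
def monoidSeries (w : Fin n → Γ) (hw : ∀ i, 0 < w i) (K : Finset (Fin n)) : HahnSeries Γ ℂ where
  coeff a := open Classical in
    if ∃ α : Fin n → ℕ, (∀ i ∉ K, α i = 0) ∧ ∑ i, α i • w i = a then 1 else 0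
  isPWO_support' := by
    -- The submonoid generated by a well-ordered set of nonnegative elements is well-ordered; here
    -- the generators are finitely many.
    refine (Set.IsPWO.addSubmonoid_closure (s := Set.range w) ?_ (Set.finite_range w).isPWO).mono ?_
    · rintro _ ⟨i, rfl⟩
      exact (hw i).le
    · intro a ha
      simp only [Function.mem_support, ne_eq, ite_eq_right_iff, one_ne_zero, imp_false,
        not_not] at ha
      obtain ⟨α, -, rfl⟩ := ha
      exact sum_mem fun i _ => nsmul_mem (AddSubmonoid.subset_closure (Set.mem_range_self i)) _

theorem coeff_monoidSeries (w : Fin n → Γ) (hw : ∀ i, 0 < w i) (K : Finset (Fin n)) (a : Γ)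
    [Decidable (∃ α : Fin n → ℕ, (∀ i ∉ K, α i = 0) ∧ ∑ i, α i • w i = a)] :
    (monoidSeries w hw K).coeff a =
      if ∃ α : Fin n → ℕ, (∀ i ∉ K, α i = 0) ∧ ∑ i, α i • w i = a then 1 else 0 := by
  simp only [monoidSeries]
  congr

/-- The exponents that use `w i` at least once are the translates by `w i` of all exponents.
Injectivity separates them from those that do not use `w i`, so the difference telescopes. -/
theorem one_sub_single_mul_monoidSeries (w : Fin n → Γ) (hw : ∀ i, 0 < w i)
    (hinj : Function.Injective fun α : Fin n → ℕ => ∑ i, α i • w i)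
    {K : Finset (Fin n)} {i : Fin n} (hi : i ∉ K) :
    (1 - HahnSeries.single (w i) 1) * monoidSeries w hw (insert i K) = monoidSeries w hw K := by
  classical
  ext a
  rw [sub_mul, one_mul, HahnSeries.coeff_sub, HahnSeries.coeff_single_mul, one_mul,
    coeff_monoidSeries, coeff_monoidSeries, coeff_monoidSeries]
  by_cases hK : ∃ α : Fin n → ℕ, (∀ j ∉ K, α j = 0) ∧ ∑ j, α j • w j = a
  · obtain ⟨α, hα, rfl⟩ := hK
    rw [if_pos ⟨α, fun j hj => hα j fun h => hj (Finset.mem_insert_of_mem h), rfl⟩, if_neg,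
      if_pos ⟨α, hα, rfl⟩, sub_zero]
    rintro ⟨β, -, hβ⟩
    have h := hinj (((sum_add_single_smul w β i).trans (eq_sub_iff_add_eq.1 hβ)) :
      (fun α : Fin n → ℕ => ∑ i, α i • w i) (β + Pi.single i 1) = _)
    have := congrFun h i
    rw [hα i hi] at this
    simp at this
  · rw [if_neg hK, sub_eq_zero]
    refine if_congr ⟨?_, ?_⟩ rfl rfl
    · rintro ⟨α, hα, rfl⟩
      have hpos : 0 < α i := by
        by_contra h0
        refine hK ⟨α, fun j hj => ?_, rfl⟩
        by_cases hji : j = i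
        · subst hji; omega
        · exact hα j (by simp [hji, hj])
      have hα' : α - Pi.single i 1 + Pi.single i 1 = α := by
        funext j
        by_cases hji : j = i
        · subst hji; simp; omega
        · simp [hji]
      refine ⟨α - Pi.single i 1, fun j hj => by simp [hα j hj], ?_⟩
      rw [eq_sub_iff_add_eq, ← sum_add_single_smul, hα']
    · rintro ⟨β, hβ, h⟩
      refine ⟨β + Pi.single i 1, fun j hj => ?_, ?_⟩
      · have hji : j ≠ i := by rintro rfl; simp at hj
        simp [hβ j hj, hji]
      · rw [sum_add_single_smul, h, sub_add_cancel]

theorem prod_inv_one_sub_single (w : Fin n → Γ) (hw : ∀ i, 0 < w i)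
    (hinj : Function.Injective fun α : Fin n → ℕ => ∑ i, α i • w i) (K : Finset (Fin n)) :
    ∏ i ∈ K, (1 - HahnSeries.single (w i) (1 : ℂ))⁻¹ = monoidSeries w hw K := by
  classical
  induction K using Finset.induction_on with
  | empty =>
    ext a
    rw [Finset.prod_empty, HahnSeries.coeff_one, coeff_monoidSeries]
    by_cases h : a = 0
    · rw [if_pos h, if_pos ⟨0, by simp, by simp [h]⟩]
    · rw [if_neg h, if_neg]
      rintro ⟨α, hα, rfl⟩
      exact h (Finset.sum_eq_zero fun i _ => by simp [hα i])
  | insert i K hi ih =>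
    rw [Finset.prod_insert hi, ih, ← one_sub_single_mul_monoidSeries w hw hinj hi,
      inv_mul_cancel_left₀ (one_sub_single_ne_zero (hw i).ne')]

end Geometric

/-! ### The two expansions of the crude generating function -/

section Crude

variable {r n : ℕ}

theorem single_one_zpow {Γ : Type} [AddCommGroup Γ] [LinearOrder Γ] [IsOrderedAddMonoid Γ]
    (a : Γ) (z : ℤ) : (HahnSeries.single a (1 : ℂ)) ^ z = HahnSeries.single (z • a) 1 := by
  cases z with
  | ofNat k => simp [HahnSeries.single_pow]
  | negSucc k =>
    rw [zpow_negSucc, HahnSeries.single_pow, HahnSeries.inv_single, one_pow, inv_one,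
      negSucc_zsmul]

theorem prod_single {ι Γ : Type} [AddCommGroup Γ] [LinearOrder Γ] [IsOrderedAddMonoid Γ]
    (s : Finset ι) (a : ι → Γ) (c : ι → ℂ) :
    ∏ i ∈ s, HahnSeries.single (a i) (c i) = HahnSeries.single (∑ i ∈ s, a i) (∏ i ∈ s, c i) := by
  classical
  induction s using Finset.induction_on with
  | empty => simp
  | insert i s hi ih =>
    rw [Finset.prod_insert hi, Finset.sum_insert hi, Finset.prod_insert hi, ih,
      HahnSeries.single_mul_single]

/-- The exponents of the monomial `λ_1^{a_{1,i}} ⋯ λ_r^{a_{r,i}} x_i`. -/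
def colExpo (ρ : Endo (r + n)) (A : Matrix (Fin r) (Fin n) ℤ) (i : Fin n) : Expo ρ :=
  (Expo.toVec ρ).symm (Fin.append (fun j => A j i) (Pi.single i 1))

theorem toVec_sum_smul_colExpo (ρ : Endo (r + n)) (A : Matrix (Fin r) (Fin n) ℤ) (α : Fin n → ℤ) :
    Expo.toVec ρ (∑ i, α i • colExpo ρ A i) = Fin.append (A *ᵥ α) α := by
  funext k
  rw [map_sum, Finset.sum_apply]
  simp only [map_zsmul, Pi.smul_apply, colExpo, AddEquiv.apply_symm_apply, smul_eq_mul]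
  refine Fin.addCases (fun j => ?_) (fun i => ?_) k
  · simp [Fin.append_left, Matrix.mulVec, dotProduct, mul_comm]
  · simp [Fin.append_right, Pi.single_apply]

theorem sum_smul_colExpo_eq_iff {ρ : Endo (r + n)} (A : Matrix (Fin r) (Fin n) ℤ) (α : Fin n → ℤ)
    {a : Expo ρ} (ha : LamFree a) :
    ∑ i, α i • colExpo ρ A i = a ↔ A *ᵥ α = 0 ∧ α = xPart a := by
  rw [← (Expo.toVec ρ).injective.eq_iff, toVec_sum_smul_colExpo]
  rw [lamFree_iff] at ha
  constructor
  · intro h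
    constructor
    · funext j
      rw [Pi.zero_apply, ← ha j, ← h, Fin.append_left]
    · funext i
      rw [xPart, ← h, Fin.append_right]
  · rintro ⟨h1, h2⟩
    funext k
    refine Fin.addCases (fun j => ?_) (fun i => ?_) k
    · rw [Fin.append_left, h1, ha j, Pi.zero_apply]
    · rw [Fin.append_right, h2, xPart]

theorem sum_smul_colExpo_injective (ρ : Endo (r + n)) (A : Matrix (Fin r) (Fin n) ℤ) :
    Function.Injective fun α : Fin n → ℤ => ∑ i, α i • colExpo ρ A i := by
  intro α β h
  have h := congrArg (Expo.toVec ρ) h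
  simp only [toVec_sum_smul_colExpo] at h
  funext i
  have := congrFun h (Fin.natAdd r i)
  rwa [Fin.append_right, Fin.append_right] at this

theorem expand_var {N : ℕ} (ρ : Endo N) (k : Fin N) :
    expand ρ (RatFun.var k) = HahnSeries.single (Expo.unit ρ k) 1 := by
  rw [RatFun.var, expand_algebraMap, polyToMN, MvPolynomial.coe_eval₂Hom, MvPolynomial.eval₂_X]

theorem expand_crude (ρ : Endo (r + n)) (A : Matrix (Fin r) (Fin n) ℤ) :
    expand ρ (crude A) = ∏ i, (1 - HahnSeries.single (colExpo ρ A i) (1 : ℂ))⁻¹ := by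
  rw [crude, map_prod]
  refine Finset.prod_congr rfl fun i _ => ?_
  rw [map_inv₀, map_sub, map_one, map_mul, map_prod]
  simp only [map_zpow₀, lam, expand_var, single_one_zpow]
  rw [prod_single, HahnSeries.single_mul_single, Finset.prod_const_one, one_mul]
  congr 4
  apply (Expo.toVec ρ).injective
  funext k
  rw [map_add, map_sum, Pi.add_apply, Finset.sum_apply]
  simp only [map_zsmul, Expo.unit, colExpo, AddEquiv.apply_symm_apply, Pi.smul_apply, smul_eq_mul]
  refine Fin.addCases (fun j => ?_) (fun i' => ?_) k
  · have h : Fin.castAdd n j ≠ Fin.natAdd r i := fun h => by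
      have := congrArg Fin.val h
      simp only [Fin.val_natAdd, Fin.val_castAdd] at this
      omega
    simp [Fin.append_left, Pi.single_apply, h]
  · have h : ∀ j : Fin r, Fin.natAdd r i' ≠ Fin.castAdd n j := fun j h => by
      have := congrArg Fin.val h
      simp only [Fin.val_natAdd, Fin.val_castAdd] at this
      omega
    simp [Fin.append_right, Pi.single_apply, h]

/-- The `x` variables come after the `λ` variables, so the last nonzero exponent is the `1` at
`x_i`, whatever the entries of `A`. -/
theorem colExpo_pos (A : Matrix (Fin r) (Fin n) ℤ) (i : Fin n) :
    0 < colExpo (idEndo (r + n)) A i := by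
  rw [Expo.lt_iff]
  refine ⟨Fin.natAdd r i, fun k hk => ?_, ?_⟩
  · change (0 : ℤ) = Fin.append (fun j => A j i) (Pi.single i 1) k
    revert hk
    refine Fin.addCases (fun j hk => ?_) (fun i' hk => ?_) k
    · rw [Fin.lt_def, Fin.val_natAdd, Fin.val_castAdd] at hk
      omega
    · have : i' ≠ i := by rintro rfl; exact lt_irrefl _ hk
      rw [Fin.append_right, Pi.single_eq_of_ne this]
  · change (0 : ℤ) < Fin.append (fun j => A j i) (Pi.single i 1) (Fin.natAdd r i)
    rw [Fin.append_right, Pi.single_eq_same]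
    exact one_pos

theorem neg_colExpo_pos (A : Matrix (Fin r) (Fin n) ℤ) (i : Fin n) :
    0 < -colExpo (rhoInv r n) A i := by
  rw [Expo.lt_iff]
  have hval : ∀ i', (rhoInv r n).1 (Expo.toVec _ (-colExpo (rhoInv r n) A i)) (Fin.natAdd r i') =
      (Pi.single i 1 : Fin n → ℤ) i' := fun i' => by
    change (if ((Fin.natAdd r i' : Fin (r + n)) : ℕ) < r then _ else
      - -Fin.append (fun j => A j i) (Pi.single i 1) (Fin.natAdd r i')) = _
    rw [if_neg (by simp), neg_neg, Fin.append_right]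
  refine ⟨Fin.natAdd r i, fun k => ?_, ?_⟩
  · rw [map_zero, map_zero]
    refine Fin.addCases (fun j hk => ?_) (fun i' hk => ?_) k
    · rw [Fin.lt_def, Fin.val_natAdd, Fin.val_castAdd] at hk
      omega
    · have : i' ≠ i := by rintro rfl; exact lt_irrefl _ hk
      rw [hval, Pi.single_eq_of_ne this]
      rfl
  · rw [map_zero, map_zero, hval, Pi.single_eq_same]
    exact one_pos

theorem natCast_injective_fun {ι : Type} :
    Function.Injective fun (α : ι → ℕ) (i : ι) => (α i : ℤ) := fun _ _ h =>
  funext fun i => Nat.cast_injective (congrFun h i)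

theorem coeff_expand_id_crude (A : Matrix (Fin r) (Fin n) ℤ) {a : Expo (idEndo (r + n))}
    (ha : LamFree a) :
    (expand (idEndo (r + n)) (crude A)).coeff a =
      cell A Finset.univ (fun _ => true) (xPart a) := by
  classical
  have hcast : ∀ α : Fin n → ℕ, ∑ i, α i • colExpo (idEndo (r + n)) A i =
      ∑ i, (fun i => (α i : ℤ)) i • colExpo (idEndo (r + n)) A i := fun α => by
    simp only [natCast_zsmul]
  rw [expand_crude, prod_inv_one_sub_single _ (colExpo_pos A), coeff_monoidSeries, cell]
  · refine if_congr ⟨?_, ?_⟩ rfl rfl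
    · rintro ⟨α, -, h⟩
      rw [hcast, sum_smul_colExpo_eq_iff A _ ha] at h
      rw [← h.2]
      exact ⟨h.1, fun i _ => by simp⟩
    · rintro ⟨h1, h2⟩
      have h3 : (fun i => (((xPart a i).toNat : ℕ) : ℤ)) = xPart a :=
        funext fun i => Int.toNat_of_nonneg ((h2 i (Finset.mem_univ i)).2 rfl)
      refine ⟨fun i => (xPart a i).toNat, fun i hi => absurd (Finset.mem_univ i) hi, ?_⟩
      rw [hcast, sum_smul_colExpo_eq_iff A _ ha, h3]
      exact ⟨h1, rfl⟩
  · intro α β h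
    simp only [hcast] at h
    exact natCast_injective_fun (sum_smul_colExpo_injective _ A h)

/-- Rewrites the factor in the inverse monomial, which is the positive one in the order of `rhoInv`.
-/
theorem inv_one_sub_single {Γ : Type} [AddCommGroup Γ] [LinearOrder Γ] [IsOrderedAddMonoid Γ]
    {v : Γ} (hv : v ≠ 0) : (1 - HahnSeries.single v (1 : ℂ))⁻¹ =
      HahnSeries.single (-v) (-1) * (1 - HahnSeries.single (-v) 1)⁻¹ := by
  have h1 := one_sub_single_ne_zero hv
  have h2 := one_sub_single_ne_zero (neg_ne_zero.2 hv)
  have h3 : HahnSeries.single (-v) (1 : ℂ) * HahnSeries.single v 1 = 1 := by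
    rw [HahnSeries.single_mul_single]; simp
  rw [HahnSeries.single_neg, ← div_eq_mul_inv, eq_div_iff h2, inv_mul_eq_iff_eq_mul₀ h1]
  linear_combination -h3

theorem coeff_expand_rhoInv_crude (A : Matrix (Fin r) (Fin n) ℤ) {a : Expo (rhoInv r n)}
    (ha : LamFree a) :
    (expand (rhoInv r n) (crude A)).coeff a =
      (-1) ^ n * cell A Finset.univ (fun _ => false) (xPart a) := by
  classical
  set w := colExpo (rhoInv r n) A with hw
  have hcast : ∀ α : Fin n → ℕ, ∑ i, α i • -w i = -∑ i, (fun i => (α i : ℤ)) i • w i := fun α => by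
    simp only [natCast_zsmul, smul_neg, Finset.sum_neg_distrib]
  -- The prefactor `m⁻¹` of every factor shifts the exponent from `-α i` to `-α i - 1`, so exactly
  -- the strictly negative vectors occur.
  have hsum : ∀ α : Fin n → ℕ, ∑ i, α i • -w i = a - ∑ i, -w i ↔
      A *ᵥ (fun i => -(α i : ℤ) - 1) = 0 ∧ (fun i => -(α i : ℤ) - 1) = xPart a := fun α => by
    rw [← sum_smul_colExpo_eq_iff A _ ha, eq_sub_iff_add_eq, hcast]
    simp only [← hw, sub_smul, one_smul, neg_smul, Finset.sum_sub_distrib, Finset.sum_neg_distrib,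
      ← sub_eq_add_neg]
  have hprod : expand (rhoInv r n) (crude A) = HahnSeries.single (∑ i, -w i) ((-1) ^ n) *
      monoidSeries (fun i => -w i) (neg_colExpo_pos A) Finset.univ := by
    rw [expand_crude, ← prod_inv_one_sub_single]
    · rw [Finset.prod_congr rfl fun i _ =>
        inv_one_sub_single (neg_ne_zero.1 (neg_colExpo_pos A i).ne'), Finset.prod_mul_distrib,
        prod_single, Finset.prod_const, Finset.card_univ, Fintype.card_fin]
    · intro α β h
      simp only [hcast, neg_inj] at h
      exact natCast_injective_fun (sum_smul_colExpo_injective _ A h)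
  rw [hprod, HahnSeries.coeff_single_mul, coeff_monoidSeries, cell]
  congr 1
  refine if_congr ⟨?_, ?_⟩ rfl rfl
  · rintro ⟨α, -, h⟩
    rw [hsum] at h
    rw [← h.2]
    refine ⟨h.1, fun i _ => ?_⟩
    simp only [Bool.false_eq_true, iff_false, not_le]
    omega
  · rintro ⟨h1, h2⟩
    have h3 : (fun i => -(((-xPart a i - 1).toNat : ℕ) : ℤ) - 1) = xPart a := funext fun i => by
      have := h2 i (Finset.mem_univ i)
      simp only [Bool.false_eq_true, iff_false, not_le] at this
      omega
    refine ⟨fun i => (-xPart a i - 1).toNat, fun i hi => absurd (Finset.mem_univ i) hi, ?_⟩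
    rw [hsum, h3]
    exact ⟨h1, rfl⟩

theorem coeff_CT_of_lamFree {ρ : Endo (r + n)} (f : MNSeries ρ) {a : Expo ρ} (ha : LamFree a) :
    (CT (lamVars r n) f).coeff a = f.coeff a :=
  if_pos ha

theorem coeff_CT_of_not_lamFree {ρ : Endo (r + n)} (f : MNSeries ρ) {a : Expo ρ}
    (ha : ¬ LamFree a) : (CT (lamVars r n) f).coeff a = 0 :=
  if_neg ha

end Crude

/-! ### Cells as the generating functions of solutions -/

section GeneratingFunctions

variable {r n : ℕ} (A : Matrix (Fin r) (Fin n) ℤ)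

theorem cell_true_vec (d : Fin n →₀ ℕ) :
    cell A Finset.univ (fun _ => true) (vec d) = MvPowerSeries.coeff d (genE A) := by
  change _ = genE A d
  rw [cell, genE]
  exact if_congr (and_iff_left fun i _ => by simp) rfl rfl

theorem cell_true_of_neg (a : Fin n → ℤ) (i : Fin n) (hi : a i < 0) :
    cell A Finset.univ (fun _ => true) a = 0 :=
  if_neg fun h => by
    have := (h.2 i (Finset.mem_univ i)).2 rfl
    omega

theorem reflect_cell_false_vec (d : Fin n →₀ ℕ) :
    reflect (cell A Finset.univ fun _ => false) (vec d) = MvPowerSeries.coeff d (genEbar A) := by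
  change _ = genEbar A d
  rw [reflect, cell, genEbar]
  refine if_congr ?_ rfl rfl
  rw [Matrix.mulVec_neg, neg_eq_zero, and_comm]
  refine and_congr ?_ Iff.rfl
  simp [pos_iff_ne_zero]

theorem reflect_cell_false_of_neg (a : Fin n → ℤ) (i : Fin n) (hi : a i < 0) :
    reflect (cell A Finset.univ fun _ => false) a = 0 :=
  if_neg fun h => by
    have := h.2 i (Finset.mem_univ i)
    simp only [Pi.neg_apply, Bool.false_eq_true, iff_false, not_le] at this
    omega

theorem reflect_reflect (f : LatFun n) : reflect (reflect f) = f := by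
  ext a; simp [reflect]

end GeneratingFunctions

end MNRecip

end

/-! ### Reciprocity for constant terms and generating functions -/

theorem mainTheorem3 (r n : ℕ) (A : Matrix (Fin r) (Fin n) ℤ)
    (hA : ∃ α : Fin n → ℤ, (∀ i, 0 < α i) ∧ A *ᵥ α = 0) :
    ∃ E Ebar G : MNRecip.RatFun (Fin n),
      -- `E = CT_Λ 𝓔`, in the field of iterated Laurent series
      MNRecip.CT (MNRecip.lamVars r n)
          (MNRecip.expand (MNRecip.idEndo (r + n)) (MNRecip.crude A)) =
        MNRecip.expand (MNRecip.idEndo (r + n)) (MNRecip.inclX r n E) ∧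
      -- `G = CT^ρ_Λ 𝓔`
      MNRecip.CT (MNRecip.lamVars r n)
          (MNRecip.expand (MNRecip.rhoInv r n) (MNRecip.crude A)) =
        MNRecip.expand (MNRecip.rhoInv r n) (MNRecip.inclX r n G) ∧
      E = (-1) ^ MNRecip.rk A * G ∧
      -- `E` and `Ebar` are the generating functions of the two sets of solutions
      MNRecip.IsRatFun (MNRecip.genE A) E ∧
      MNRecip.IsRatFun (MNRecip.genEbar A) Ebar ∧
      E = (-1) ^ (n - MNRecip.rk A) * MNRecip.invVars Ebar := by
  obtain ⟨E, hE⟩ := MNRecip.exists_represents (MNRecip.cell_mem_sat hA Finset.univ fun _ => true)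
  obtain ⟨F, hF⟩ := MNRecip.exists_represents (MNRecip.cell_mem_sat hA Finset.univ fun _ => false)
  -- `F` and its double inversion are both rational sums of the same series, so uniqueness gives
  -- equality.
  have hFinv : MNRecip.invVars (MNRecip.invVars F) = F := by
    have h := hF.reflect.reflect.eq_mul hF (c := 1) (by
      rw [MNRecip.reflect_reflect, one_smul, sub_self]
      exact Submodule.zero_mem _)
    rwa [MvPolynomial.C_1, map_one, one_mul] at h
  have hEF : E = (-1) ^ (n - MNRecip.rk A) * F := by
    have h := hE.eq_mul hF (c := (-1) ^ (n - MNRecip.rk A))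
      (MNRecip.cellDiff_mem_torsion hA Finset.univ fun _ => true)
    simpa using h
  -- `F` is the sum over negative solutions: inverting the variables gives the positive ones, and
  -- the `n` factors `-m⁻¹` account for `(-1) ^ n`.
  refine ⟨E, MNRecip.invVars F, (-1) ^ n * F, ?_, ?_, ?_, ?_, ?_, ?_⟩
  · refine hE.expand_inclX (fun a ha => ?_) fun a ha => MNRecip.coeff_CT_of_not_lamFree _ ha
    rw [MNRecip.coeff_CT_of_lamFree _ ha, MNRecip.coeff_expand_id_crude A ha]
  · have hG : MNRecip.Represents ((-1 : ℂ) ^ n • MNRecip.cell A Finset.univ fun _ => false)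
        ((-1) ^ n * F) := by
      simpa using hF.smul ((-1) ^ n)
    refine hG.expand_inclX (fun a ha => ?_) fun a ha => MNRecip.coeff_CT_of_not_lamFree _ ha
    rw [MNRecip.coeff_CT_of_lamFree _ ha, MNRecip.coeff_expand_rhoInv_crude A ha]
    rfl
  · rw [hEF, ← mul_assoc, ← pow_add]
    congr 1
    have hrk := MNRecip.rk_le A
    -- The exponents agree modulo 2; truncated subtraction is harmless because the rank is at most
    -- `n`.
    rw [show MNRecip.rk A + n = n - MNRecip.rk A + 2 * MNRecip.rk A by omega, pow_add,
      (even_two_mul _).neg_one_pow, mul_one]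
  · exact hE.isRatFun (MNRecip.cell_true_vec A) (MNRecip.cell_true_of_neg A)
  · exact hF.reflect.isRatFun (MNRecip.reflect_cell_false_vec A)
      (MNRecip.reflect_cell_false_of_neg A)
  · rw [hFinv, hEF]
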